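/- A ribbon graph $G$ is a (possibly non-orientable) surface with boundary, represented as a union of finitely many discs, called vertices ($V(G)$) and edges ($E(G)$), such that vertices and edges meet in disjoint line segments, each such segment lies on the boundary of exactly one vertex and exactly one edge, and every edge contains exactly two such segments. For $A\subseteq E(G)$ let $A^c=E(G)\setminus A$, let $G|_A$ be the ribbon subgraph consisting of the edges in $A$ and the vertices incident with them, and let $G-A$ be the spanning ribbon subgraph $(V(G),A^c)$. A connected ribbon graph is called plane if its Euler genus is $0$, and an $\mathbb{R}\mathrm{P}^2$ ribbon graph if its Euler genus is $1$; here the Euler genus is $2g$ in the orientable case and $g$ in the non-orientable case, where $g$ is the genus of the surface (equivalently, it is $2-\chi$ of the closed surface obtained by capping off all boundary components). The partial dual $G^A$ is obtained as follows. Orient the boundary of every edge disc of $G$ arbitrarily. The boundary components of the spanning ribbon subgraph $(V(G),A)$ meet the edges of $G$ in disjoint arcs; on each of them place an arrow in the direction of the orientation of the boundary of the edge, labelled by that edge. The vertices of $G^A$ are discs bounded by these boundary components, and the edge discs of $G^A$ are attached along the arrows with the same label, compatibly with their directions. A ribbon graph $L$ is a $1$-sum $P\oplus Q$, occurring at the vertex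 $v$, if $P,Q$ are connected ribbon subgraphs of $L$, each with at least one edge, with $L=P\cup Q$ and $P\cap Q=\{v\}$. For connected $G$, a set $A\subseteq E(G)$ defines a biseparation of $G$ if $A=\emptyset$, or $A=E(G)$, or $$G=(\cdots((H_1\oplus H_2)\oplus H_3)\oplus\cdots)\oplus H_l ,$$ where $H_1,\dots,H_l$ are the connected components of $G|_A$ and of $G|_{A^c}$, each occurring exactly once, and each $1$-sum in the sequence involves a component of $G|_A$ and a component of $G|_{A^c}$ (that is, one of $H_j$ and some $H_i$, $i<j$, containing the vertex at which $H_j$ is added, is a component of $G|_A$ and the other is a component of $G|_{A^c}$). It is a plane-biseparation if moreover every component of $G|_A$ and of $G-A$ is plane, and an $\mathbb{R}\mathrm{P}^2$-biseparation if moreover exactly one component of $G|_A$ or of $G-A$ is $\mathbb{R}\mathrm{P}^2$ and all other components are plane. **Theorem.** Let $G$ be a connected ribbon graph and $A\subseteq E(G)$. Then 1. $G^A$ is a plane ribbon graph if and only if $A$ defines a plane-biseparation of $G$; 2. $G^A$ is an $\mathbb{R}\mathrm{P}^2$ ribbon graph if and only if $A$ defines an $\mathbb{R}\mathrm{P}^2$-biseparation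 of $G$. -/

import Mathlib

/-- A ribbon graph with vertex discs `V`, edge discs `E`, and set of corners `F`.

A ribbon graph is a union of vertex discs and edge discs meeting in disjoint line segments, each
segment on the boundary of exactly one vertex and exactly one edge, every edge containing exactly
two segments. The end points of the segments are the *corners*; there are four on every edge.
At each corner exactly three arcs end:
* the common line segment of an edge and a vertex, whose other end is `seg x`;
* a free side of the edge disc, whose other end is `side x`;
* a free arc of the boundary circle of the vertex disc, whose other end is `gap x`.

So the boundary of an edge disc is a rectangle with sides alternately of type `seg` and `side`, and
the boundary circle of a vertex disc is a cycle of arcs alternately of type `seg` and `gap`, except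
that a vertex meeting no edge has no corners. These data determine the surface with its
decomposition into discs up to homeomorphism, and every ribbon graph has such a description. In the
language of arrow presentations: the marking arrows are the pairs `{x, seg x}`, the cycles are the
vertices, and `side` joins the head of each arrow to the tail of the other arrow with
the same label. -/
structure RibbonGraph (V E F : Type*) where
  /-- the vertex on whose boundary a corner lies -/
  vert : F → V
  /-- the edge on whose boundary a corner lies -/
  edge : F → E
  /-- the other end of the line segment in which the edge and the vertex meet -/
  seg : F → F
  /-- the other end of the free side of the edge -/
  side : F → F
  /-- the other end of the free arc of the vertex boundary -/
  gap : F → F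
  seg_seg : ∀ x, seg (seg x) = x
  seg_ne : ∀ x, seg x ≠ x
  side_side : ∀ x, side (side x) = x
  side_ne : ∀ x, side x ≠ x
  gap_gap : ∀ x, gap (gap x) = x
  gap_ne : ∀ x, gap x ≠ x
  seg_side : ∀ x, seg (side x) = side (seg x)
  seg_ne_side : ∀ x, seg x ≠ side x
  /-- the corners of an edge are the four corners of one rectangle -/
  edge_eq_iff : ∀ x y, edge x = edge y ↔ y = x ∨ y = seg x ∨ y = side x ∨ y = seg (side x)
  edge_surjective : Function.Surjective edge
  /-- the corners on a vertex form one cycle of arcs of type `seg` and `gap` -/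
  vert_eq_iff : ∀ x y, vert x = vert y ↔
    Relation.EqvGen (fun u w => w = seg u ∨ w = gap u) x y

namespace RibbonGraph

variable {V E F : Type*} (G : RibbonGraph V E F)

theorem edge_seg (x : F) : G.edge (G.seg x) = G.edge x :=
  ((G.edge_eq_iff x (G.seg x)).2 (Or.inr (Or.inl rfl))).symm

theorem edge_side (x : F) : G.edge (G.side x) = G.edge x :=
  ((G.edge_eq_iff x (G.side x)).2 (Or.inr (Or.inr (Or.inl rfl)))).symm

/-! ### Boundary components and partial duals -/

open Classical in
/-- The arcs other than the `gap` arcs which make up the boundary of the spanning ribbon subgraph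
`(V, B)`: the free sides of the edges in `B`, and the segments in which the (removed)
edges outside `B` met the vertices. These are the arcs in which the boundary of `(V, B)` meets the
edges of `G`. -/
noncomputable def twist (B : Set E) (x : F) : F :=
  if G.edge x ∈ B then G.side x else G.seg x

/-- Two corners are equivalent if they lie on the same boundary component of the spanning
ribbon subgraph `(V, B)`. -/
def boundarySetoid (B : Set E) : Setoid F :=
  Relation.EqvGen.setoid (fun u w => w = G.twist B u ∨ w = G.gap u)

/-- The vertices of `G` meeting no edge of `G`. -/
abbrev BareVertex : Type _ := {v : V // ∀ x, G.vert x ≠ v}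

/-- The boundary components of the spanning ribbon subgraph `(V, B)`: those containing corners of
`G`, and the boundary circles of the vertices meeting no edge of `G`. -/
abbrev BoundaryComponent (B : Set E) : Type _ :=
  Quotient (G.boundarySetoid B) ⊕ G.BareVertex

theorem edge_twist (B : Set E) (x : F) : G.edge (G.twist B x) = G.edge x := by
  unfold twist
  split_ifs
  · exact G.edge_side x
  · exact G.edge_seg x

theorem twist_twist (B : Set E) (x : F) : G.twist B (G.twist B x) = x := by
  by_cases h : G.edge x ∈ B
  · simp [twist, h, G.edge_side, G.side_side]
  · simp [twist, h, G.edge_seg, G.seg_seg]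

/-- The partial dual `G^A`. Its vertices are discs bounded by the boundary components of the
spanning ribbon subgraph `(V, A)`. Marking arrows are placed on the arcs in which these boundary
components meet the edges of `G`, that is, on the two free sides of every edge in `A` and on the two
attaching segments of every other edge, directed along an orientation of the boundary of the edge;
the edges of `G^A` are attached along these arrows, so that their free sides are the other two arcs
of the boundary of the edge. -/
noncomputable def partialDual (A : Set E) : RibbonGraph (G.BoundaryComponent A) E F where
  vert x := Sum.inl (Quotient.mk (G.boundarySetoid A) x)
  edge := G.edge
  seg := G.twist A
  side := G.twist Aᶜ
  gap := G.gap
  seg_seg := G.twist_twist A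
  seg_ne x := by
    unfold twist
    split_ifs
    · exact G.side_ne x
    · exact G.seg_ne x
  side_side := G.twist_twist Aᶜ
  side_ne x := by
    unfold twist
    split_ifs
    · exact G.side_ne x
    · exact G.seg_ne x
  gap_gap := G.gap_gap
  gap_ne := G.gap_ne
  seg_side x := by
    by_cases h : G.edge x ∈ A
    · simp [twist, h, G.edge_seg, G.edge_side, G.seg_side]
    · simp [twist, h, G.edge_seg, G.edge_side, G.seg_side]
  seg_ne_side x := by
    by_cases h : G.edge x ∈ A
    · simpa [twist, h] using (G.seg_ne_side x).symm
    · simpa [twist, h] using G.seg_ne_side x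
  edge_eq_iff x y := by
    rw [G.edge_eq_iff]
    by_cases h : G.edge x ∈ A
    · simp only [twist, h, G.edge_seg, Set.mem_compl_iff, not_true_eq_false, if_true, if_false,
        ← G.seg_side]
      tauto
    · simp [twist, h, G.edge_side]
  edge_surjective := G.edge_surjective
  vert_eq_iff x y := by
    rw [Sum.inl.injEq, Quotient.eq]
    rfl

/-! ### Ribbon subgraphs -/

/-- A ribbon subgraph of `G`: a set of vertices and a set of edges of `G` such that the vertices
incident with these edges are among these vertices. -/
@[ext]
structure Subgraph where
  verts : Set V
  edges : Set E
  vert_mem : ∀ x, G.edge x ∈ edges → G.vert x ∈ verts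

namespace Subgraph

variable {G}

instance : PartialOrder G.Subgraph :=
  PartialOrder.lift (fun H => (H.verts, H.edges)) (fun H K h => by
    rw [Prod.mk.injEq] at h
    exact Subgraph.ext h.1 h.2)

/-- `H` has at least one vertex, and any two of its vertices are joined by a path of edges
of `H`. (The corners `x` and `side x` lie at the two ends of an edge.) -/
def Connected (H : G.Subgraph) : Prop :=
  H.verts.Nonempty ∧ ∀ v ∈ H.verts, ∀ w ∈ H.verts,
    Relation.ReflTransGen
      (fun a b => ∃ x, G.edge x ∈ H.edges ∧ G.vert x = a ∧ G.vert (G.side x) = b) v w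

/-- `K` is a (connected) component of `H`. -/
def IsComponent (H K : G.Subgraph) : Prop :=
  Maximal (fun L : G.Subgraph => L ≤ H ∧ L.Connected) K

/-- `H` is orientable as a surface: its discs can be oriented compatibly. An orientation of
a disc amounts to a colouring of the corners on its boundary by two colours which alternate along
the boundary circle (the colour tells whether the segment at the corner is left or entered there
when the circle is traversed positively); orientations of a vertex and of an edge are
compatible if they traverse common segments in opposite directions. After exchanging the colours on
all edge discs, this means that there is one colouring which alternates along all arcs. -/
def Orientable (H : G.Subgraph) : Prop :=
  ∃ c : F → Bool, ∀ x, G.vert x ∈ H.verts →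
    c (G.seg x) = !c x ∧ c (G.gap x) = !c x ∧ (G.edge x ∈ H.edges → c (G.side x) = !c x)

/-- The boundary components of `H`: the boundary components of the spanning ribbon subgraph with
the same edges which lie on `H`. -/
def boundary (H : G.Subgraph) : Set (G.BoundaryComponent H.edges) :=
  {b | (∃ x, G.vert x ∈ H.verts ∧ b = Sum.inl (Quotient.mk (G.boundarySetoid H.edges) x)) ∨
    ∃ v : G.BareVertex, v.1 ∈ H.verts ∧ b = Sum.inr v}

/-- The Euler characteristic of the closed surface obtained from `H` by capping off
all its boundary components with discs. -/
noncomputable def cappedEulerChar (H : G.Subgraph) : ℤ :=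
  (H.verts.ncard : ℤ) - (H.edges.ncard : ℤ) + (H.boundary.ncard : ℤ)

open Classical in
/-- The genus of a connected ribbon graph, viewed as a punctured surface, so that the
Euler characteristic of the capped-off surface is `2 - 2g` in the orientable case and `2 - g` in the
non-orientable case. -/
noncomputable def genus (H : G.Subgraph) : ℚ :=
  if H.Orientable then (2 - (H.cappedEulerChar : ℚ)) / 2 else 2 - (H.cappedEulerChar : ℚ)

open Classical in
/-- The Euler genus of a connected ribbon graph. -/
noncomputable def eulerGenus (H : G.Subgraph) : ℚ :=
  if H.Orientable then 2 * H.genus else H.genus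

/-- Plane ribbon graphs. -/
def IsPlane (H : G.Subgraph) : Prop := H.Connected ∧ H.eulerGenus = 0

/-- Ribbon graphs in the real projective plane. -/
def IsRP2 (H : G.Subgraph) : Prop := H.Connected ∧ H.eulerGenus = 1

/-- `L` is the 1-sum `P ⊕ Q`, occurring at the vertex `v`: `P` and `Q` are connected and
non-trivial (not just isolated vertices), `L = P ∪ Q` and `P ∩ Q = {v}`. -/
def IsOneSum (L P Q : G.Subgraph) (v : V) : Prop :=
  P.Connected ∧ Q.Connected ∧ P.edges.Nonempty ∧ Q.edges.Nonempty ∧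
  L.verts = P.verts ∪ Q.verts ∧ L.edges = P.edges ∪ Q.edges ∧
  P.verts ∩ Q.verts = {v} ∧ P.edges ∩ Q.edges = ∅

/-- `IsOneSumSeq R [H₁, …, H_l] L` means that `L = (⋯((H₁ ⊕ H₂) ⊕ H₃) ⊕ ⋯) ⊕ H_l` is a sequence of
1-sums, where every 1-sum `(H₁ ⊕ ⋯ ⊕ H_{j-1}) ⊕ H_j` in it, occurring at `v` say, involves `H_j` and
some `H_i` with `i < j` that contains `v` and satisfies `R H_i H_j`. -/
inductive IsOneSumSeq (R : G.Subgraph → G.Subgraph → Prop) : List G.Subgraph → G.Subgraph → Prop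
  | single (H : G.Subgraph) : H.Connected → H.edges.Nonempty → IsOneSumSeq R [H] H
  | snoc (l : List G.Subgraph) (K L H H' : G.Subgraph) (v : V) :
      IsOneSumSeq R l K → IsOneSum L K H v → H' ∈ l → v ∈ H'.verts → R H' H →
      IsOneSumSeq R (l ++ [H]) L

end Subgraph

/-- `G` regarded as a ribbon subgraph of itself. -/
def full : G.Subgraph where
  verts := Set.univ
  edges := Set.univ
  vert_mem _ _ := Set.mem_univ _

/-- The ribbon subgraph `G|_A` induced by `A`: the edges in `A` and their incident vertices. -/
def induced (A : Set E) : G.Subgraph where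
  verts := {v | ∃ x, G.edge x ∈ A ∧ G.vert x = v}
  edges := A
  vert_mem x hx := ⟨x, hx, rfl⟩

/-- The ribbon subgraph `G - A` obtained by deleting the edges in `A`. -/
def delete (A : Set E) : G.Subgraph where
  verts := Set.univ
  edges := Aᶜ
  vert_mem _ _ := Set.mem_univ _

/-- `G` is connected. -/
def Connected : Prop := G.full.Connected

/-- `G` is a plane ribbon graph. -/
def IsPlane : Prop := G.full.IsPlane

/-- `G` is an `ℝP²` ribbon graph. -/
def IsRP2 : Prop := G.full.IsRP2

/-! ### Biseparations -/

/-- `A` defines a biseparation of `G`: either `A` is trivial, or `G` can be written as a sequence of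
1-sums of the components of `G|_A` and of `G|_{Aᶜ}`, each occurring once, such that every 1-sum
involves a component of `G|_A` and a component of `G|_{Aᶜ}`. -/
def DefinesBiseparation (A : Set E) : Prop :=
  A = Set.univ ∨ A = ∅ ∨
  ∃ l : List G.Subgraph, l.Nodup ∧
    (∀ H, H ∈ l ↔ (G.induced A).IsComponent H ∨ (G.induced Aᶜ).IsComponent H) ∧
    Subgraph.IsOneSumSeq
      (fun P Q => ((G.induced A).IsComponent P ∧ (G.induced Aᶜ).IsComponent Q) ∨
        ((G.induced Aᶜ).IsComponent P ∧ (G.induced A).IsComponent Q)) l G.full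

/-- `A` defines a plane-biseparation of `G`: it defines a biseparation in which every component of
`G|_A` and of `G - A` is plane. -/
def DefinesPlaneBiseparation (A : Set E) : Prop :=
  G.DefinesBiseparation A ∧
  ∀ K, (G.induced A).IsComponent K ∨ (G.delete A).IsComponent K → K.IsPlane

/-- `A` defines an `ℝP²`-biseparation of `G`: it defines a biseparation in which exactly one
component of `G|_A` or of `G - A` is `ℝP²` and all of the other components are plane. -/
def DefinesRP2Biseparation (A : Set E) : Prop :=
  G.DefinesBiseparation A ∧
  ∃ K, ((G.induced A).IsComponent K ∨ (G.delete A).IsComponent K) ∧ K.IsRP2 ∧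
    ∀ K', (G.induced A).IsComponent K' ∨ (G.delete A).IsComponent K' → K' ≠ K → K'.IsPlane

end RibbonGraph

/-! Write `γ(B)` for the sum of the Euler genera of the components of `(V, B)` and `k(B)` for their
number. The vertices of `G^A` are the boundary components of `(V, A)`. The free sides of its edges
are the arcs left over, so its own boundary components are those of `(V, Aᶜ)`. Counting cells gives
`γ(G^A) = γ(A) + γ(Aᶜ) + 2c` with `c = 1 + |V| - k(A) - k(Aᶜ)`
(`two_sub_cappedEulerChar_partialDual`).

Here `c` is the cycle rank of a bipartite graph: its nodes are the components of `(V, A)` and of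
`(V, Aᶜ)`, and each vertex of `G` is an edge joining the two components that contain it. This graph
is connected because `G` is, so `c ≥ 0` (`cycleRank_nonneg`), and it is a tree exactly when the
pieces fit together by 1-sums (`definesBiseparation_iff`).

Every component has Euler genus at least `0`, because `γ` does not decrease when an edge is added
(`totalGenus_le_insert`, `totalGenus_nonneg`). So the total is `0` iff `c` and all genera vanish. It
is `1` iff `c = 0` and exactly one component has Euler genus `1`, the others `0`. Isolated vertices
are plane, so it makes no difference whether they are counted as components. -/

namespace Setoid

variable {α : Type*}

/-! ### Counting classes when two of them are merged -/

theorem card_quotient_le_of_le [Finite α] {r s : Setoid α} (h : r ≤ s) :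
    Nat.card (Quotient s) ≤ Nat.card (Quotient r) := by
  refine Nat.card_le_card_of_surjective (Quotient.map' (s₂ := s) id fun a b hab => h hab) ?_
  intro q
  induction q using Quotient.inductionOn with
  | h a => exact ⟨Quotient.mk r a, rfl⟩

theorem card_quotient_lt_of_le [Finite α] {r s : Setoid α} (h : r ≤ s) {a b : α}
    (hr : ¬ r a b) (hs : s a b) : Nat.card (Quotient s) < Nat.card (Quotient r) := by
  let φ : Quotient r → Quotient s := Quotient.map' (s₂ := s) id fun a b hab => h hab
  have hφ : Function.Surjective φ := by
    intro q
    induction q using Quotient.inductionOn with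
    | h a => exact ⟨Quotient.mk r a, rfl⟩
  refine lt_of_le_of_ne (Nat.card_le_card_of_surjective φ hφ) fun hc => hr ?_
  have hinj : Function.Injective φ := ((Nat.bijective_iff_surjective_and_card φ).2 ⟨hφ, hc.symm⟩).1
  exact Quotient.exact (hinj (Quotient.sound hs : φ (Quotient.mk r a) = φ (Quotient.mk r b)))

/-- The equivalence relation obtained from `r` by merging the classes of `a` and `b`. -/
def glue (r : Setoid α) (a b : α) : Setoid α where
  r u w := r u w ∨ (r u a ∨ r u b) ∧ (r w a ∨ r w b)
  iseqv := by
    refine ⟨fun u => Or.inl (r.refl' u), ?_, ?_⟩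
    · rintro u w (h | h)
      · exact Or.inl (r.symm' h)
      · exact Or.inr h.symm
    · have key : ∀ {u w c}, r u w → r w c → r u c := fun h h' => r.trans' h h'
      rintro u w t (h | h) (h' | h')
      · exact Or.inl (key h h')
      · exact Or.inr ⟨h'.1.imp (key h) (key h), h'.2⟩
      · exact Or.inr ⟨h.1, h.2.imp (key (r.symm' h')) (key (r.symm' h'))⟩
      · exact Or.inr ⟨h.1, h'.2⟩

theorem le_glue (r : Setoid α) (a b : α) : r ≤ r.glue a b := fun _ _ h => Or.inl h

/-- Send the `r`-class of `a` to `none` and every other class to its image. Away from the class of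
`a`, `s` identifies nothing that `r` keeps apart, so this map is injective. -/
theorem card_quotient_le_succ [Finite α] {r s : Setoid α} {a b : α} (h : r ≤ s)
    (hs : s ≤ r.glue a b) : Nat.card (Quotient r) ≤ Nat.card (Quotient s) + 1 := by
  classical
  let φ : Quotient r → Option (Quotient s) := fun q =>
    if q = Quotient.mk r a then none
    else some (Quotient.map' (s₂ := s) id (fun a b hab => h hab) q)
  rw [← Finite.card_option]
  refine Nat.card_le_card_of_injective φ ?_
  intro p q hpq
  by_cases hp : p = Quotient.mk r a
  · by_cases hq : q = Quotient.mk r a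
    · rw [hp, hq]
    · simp [φ, hp, hq] at hpq
  · by_cases hq : q = Quotient.mk r a
    · simp [φ, hp, hq] at hpq
    · simp only [φ, hp, hq, if_false, Option.some.injEq] at hpq
      induction p using Quotient.inductionOn with | h u =>
      induction q using Quotient.inductionOn with | h w =>
      have hp' : ¬ r u a := fun h' => hp (Quotient.sound h')
      have hq' : ¬ r w a := fun h' => hq (Quotient.sound h')
      have hsuw : s u w := Quotient.exact hpq
      rcases hs hsuw with h' | ⟨h1, h2⟩
      · exact Quotient.sound h'
      · exact Quotient.sound
          (r.trans' (h1.resolve_left hp') (r.symm' (h2.resolve_left hq')))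

end Setoid

/-- A finite set which is mapped to itself by a fixed-point-free involution has an even number of
elements. -/
theorem Finset.even_card_of_involutive {α : Type*} (s : Finset α) (g : α → α)
    (hg : ∀ a, g (g a) = a) (hne : ∀ a ∈ s, g a ≠ a) (hs : ∀ a ∈ s, g a ∈ s) : Even s.card := by
  have h : ∑ _a ∈ s, (1 : ZMod 2) = 0 :=
    Finset.sum_involution (fun a _ => g a) (fun _ _ => by decide) (fun a ha _ => hne a ha)
      hs (fun a _ => hg a)
  rw [Finset.sum_const, nsmul_one] at h
  exact (ZMod.natCast_eq_zero_iff_even).1 h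

/-! ### The effect of adding one edge to a spanning ribbon subgraph -/

namespace RibbonGraph

variable {V E F : Type*} (G : RibbonGraph V E F)

theorem vert_seg (x : F) : G.vert (G.seg x) = G.vert x :=
  ((G.vert_eq_iff x _).2 (.rel _ _ (Or.inl rfl))).symm

theorem vert_gap (x : F) : G.vert (G.gap x) = G.vert x :=
  ((G.vert_eq_iff x _).2 (.rel _ _ (Or.inr rfl))).symm

theorem twist_of_mem {B : Set E} {x : F} (h : G.edge x ∈ B) : G.twist B x = G.side x := if_pos h

theorem twist_of_notMem {B : Set E} {x : F} (h : G.edge x ∉ B) : G.twist B x = G.seg x := if_neg h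

theorem twist_congr {B B' : Set E} {x : F} (h : G.edge x ∈ B ↔ G.edge x ∈ B') :
    G.twist B x = G.twist B' x := by
  by_cases hB : G.edge x ∈ B
  · rw [G.twist_of_mem hB, G.twist_of_mem (h.1 hB)]
  · rw [G.twist_of_notMem hB, G.twist_of_notMem (h.not.1 hB)]

theorem twist_ne (B : Set E) (x : F) : G.twist B x ≠ x := by
  unfold twist
  split_ifs
  · exact G.side_ne x
  · exact G.seg_ne x

/-- Two vertices are equivalent if they lie in the same component of the spanning ribbon
subgraph `(V, B)`. -/
def reachSetoid (B : Set E) : Setoid V where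
  r := Relation.ReflTransGen
    (fun a b => ∃ x, G.edge x ∈ B ∧ G.vert x = a ∧ G.vert (G.side x) = b)
  iseqv := by
    refine ⟨fun _ => .refl, fun h => ?_, fun h h' => h.trans h'⟩
    refine Relation.ReflTransGen.mono ?_ _ _ (Relation.reflTransGen_swap.2 h)
    rintro a b ⟨x, hx, ha, hb⟩
    exact ⟨G.side x, by rwa [G.edge_side], hb, by rwa [G.side_side]⟩

theorem reachSetoid_le {B : Set E} {s : Setoid V}
    (h : ∀ x, G.edge x ∈ B → s (G.vert x) (G.vert (G.side x))) : G.reachSetoid B ≤ s := by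
  intro a b hab
  induction hab with
  | refl => exact s.refl' _
  | tail _ hbc ih =>
    obtain ⟨x, hx, rfl, rfl⟩ := hbc
    exact s.trans' ih (h x hx)

theorem reach_side {B : Set E} {x : F} (h : G.edge x ∈ B) :
    G.reachSetoid B (G.vert x) (G.vert (G.side x)) :=
  .single ⟨x, h, rfl, rfl⟩

theorem reach_mono {B B' : Set E} (h : B ⊆ B') : G.reachSetoid B ≤ G.reachSetoid B' :=
  G.reachSetoid_le fun _ hx => G.reach_side (h hx)

theorem reach_twist (B : Set E) (x : F) :
    G.reachSetoid B (G.vert x) (G.vert (G.twist B x)) := by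
  by_cases h : G.edge x ∈ B
  · rw [G.twist_of_mem h]
    exact G.reach_side h
  · rw [G.twist_of_notMem h, G.vert_seg]

theorem boundary_twist (B : Set E) (x : F) : G.boundarySetoid B x (G.twist B x) :=
  .rel _ _ (Or.inl rfl)

theorem boundary_gap (B : Set E) (x : F) : G.boundarySetoid B x (G.gap x) :=
  .rel _ _ (Or.inr rfl)

theorem boundarySetoid_le {B : Set E} {s : Setoid F} (ht : ∀ x, s x (G.twist B x))
    (hg : ∀ x, s x (G.gap x)) : G.boundarySetoid B ≤ s := by
  refine Setoid.eqvGen_le ?_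
  rintro x y (rfl | rfl)
  · exact ht x
  · exact hg x

theorem reach_of_boundary {B : Set E} {x y : F} (h : G.boundarySetoid B x y) :
    G.reachSetoid B (G.vert x) (G.vert y) := by
  have : G.boundarySetoid B ≤ (G.reachSetoid B).comap G.vert :=
    G.boundarySetoid_le (G.reach_twist B) fun x => by
      change G.reachSetoid B _ _
      rw [G.vert_gap]
  exact this h

theorem corner_cases {x y : F} (h : G.edge y = G.edge x) :
    y = x ∨ y = G.seg x ∨ y = G.side x ∨ y = G.seg (G.side x) :=
  (G.edge_eq_iff x y).1 h.symm

/-- The number of boundary components of the spanning ribbon subgraph `(V, B)`. -/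
noncomputable def numBoundary (B : Set E) : ℕ := Nat.card (G.BoundaryComponent B)

/-- The number of components of the spanning ribbon subgraph `(V, B)`. -/
noncomputable def numComponents (B : Set E) : ℕ := Nat.card (Quotient (G.reachSetoid B))

/-- The sum of the Euler genera of the components of the spanning ribbon subgraph `(V, B)`. -/
noncomputable def totalGenus (B : Set E) : ℤ :=
  2 * G.numComponents B - Nat.card V + B.ncard - G.numBoundary B

theorem numBoundary_eq [Finite V] [Finite F] (B : Set E) :
    G.numBoundary B = Nat.card (Quotient (G.boundarySetoid B)) + Nat.card G.BareVertex :=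
  Nat.card_sum

/-- Once the edge is present, its free sides pair its four corners into the class of `x` and the
class of `seg x`. The old boundary differs only at these corners, so merging these two classes
absorbs it. -/
theorem boundarySetoid_insert_le_glue (B : Set E) (x : F) :
    G.boundarySetoid B ≤ (G.boundarySetoid (insert (G.edge x) B)).glue x (G.seg x) := by
  set r := G.boundarySetoid (insert (G.edge x) B) with hr
  have hx : ∀ y, G.edge y = G.edge x → r y x ∨ r y (G.seg x) := by
    intro y hy
    have hside : ∀ z, G.edge z = G.edge x → r (G.side z) z := by
      intro z hz
      have := G.boundary_twist (insert (G.edge x) B) z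
      rw [G.twist_of_mem (by simp [hz])] at this
      exact r.symm' this
    rcases G.corner_cases hy with rfl | rfl | rfl | rfl
    · exact Or.inl (r.refl' _)
    · exact Or.inr (r.refl' _)
    · exact Or.inl (hside _ rfl)
    · rw [G.seg_side]
      exact Or.inr (hside _ (G.edge_seg x))
  refine G.boundarySetoid_le (fun y => ?_) fun y => Or.inl (G.boundary_gap _ y)
  by_cases hy : G.edge y = G.edge x
  · exact Or.inr ⟨hx y hy, hx _ (by rw [G.edge_twist, hy])⟩
  · left
    have := G.boundary_twist (insert (G.edge x) B) y
    have he : G.twist (insert (G.edge x) B) y = G.twist B y :=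
      G.twist_congr (Set.mem_insert_iff.trans (or_iff_right hy))
    rwa [he] at this

/-- Compare both relations with their join: it coarsens the old one and merges at most two classes
of the new one. -/
theorem numBoundary_insert_le [Finite V] [Finite F] (B : Set E) (x : F) :
    G.numBoundary (insert (G.edge x) B) ≤ G.numBoundary B + 1 := by
  have h1 := Setoid.card_quotient_le_succ
    (le_sup_right : _ ≤ G.boundarySetoid B ⊔ G.boundarySetoid (insert (G.edge x) B))
    (sup_le (G.boundarySetoid_insert_le_glue B x) (Setoid.le_glue _ _ _))
  have h2 := Setoid.card_quotient_le_of_le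
    (le_sup_left : _ ≤ G.boundarySetoid B ⊔ G.boundarySetoid (insert (G.edge x) B))
  rw [numBoundary_eq, numBoundary_eq]
  omega

/-- If an edge joins two components of `(V, B)`, then its two free sides belong to the same boundary
component after the edge is added. -/
theorem boundary_insert_seg [Finite F] (B : Set E) (x : F)
    (h : ¬ G.reachSetoid B (G.vert x) (G.vert (G.side x))) :
    G.boundarySetoid (insert (G.edge x) B) x (G.seg x) := by
  classical
  have := Fintype.ofFinite F
  by_contra hseg
  set r := G.boundarySetoid (insert (G.edge x) B) with hr
  -- Parity: `S` consists of the corners of the new boundary component through `x` that lie in the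
  -- old component of `x`. `gap` pairs them all. If `seg x` were not on this boundary component, `x`
  -- would be the only corner of its edge in `S`, and `twist B` would pair the rest.
  let S : Finset F := Finset.univ.filter
    fun y => r x y ∧ G.reachSetoid B (G.vert x) (G.vert y)
  have hxS : x ∈ S := by
    simp only [S, Finset.mem_filter, Finset.mem_univ, true_and]
    exact ⟨r.refl' _, Setoid.refl' _ _⟩
  have h1 : Even S.card := by
    refine S.even_card_of_involutive G.gap G.gap_gap (fun y _ => G.gap_ne y) fun y hy => ?_
    simp only [S, Finset.mem_filter, Finset.mem_univ, true_and] at hy ⊢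
    exact ⟨r.trans' hy.1 (G.boundary_gap _ _), by rw [G.vert_gap]; exact hy.2⟩
  have heB : G.edge x ∉ B := fun he => h (G.reach_side he)
  have h2 : Even (S.erase x).card := by
    refine (S.erase x).even_card_of_involutive (G.twist B) (G.twist_twist B)
      (fun y _ => G.twist_ne B y) fun y hy => ?_
    simp only [S, Finset.mem_erase, Finset.mem_filter, Finset.mem_univ, true_and] at hy ⊢
    obtain ⟨hyx, hry, hvy⟩ := hy
    by_cases hye : G.edge y = G.edge x
    · exfalso
      rcases G.corner_cases hye with rfl | rfl | rfl | rfl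
      · exact hyx rfl
      · exact hseg hry
      · exact h hvy
      · rw [G.vert_seg] at hvy
        exact h hvy
    · have he : G.twist (insert (G.edge x) B) y = G.twist B y :=
        G.twist_congr (Set.mem_insert_iff.trans (or_iff_right hye))
      refine ⟨fun hc => hye ?_, ?_, Setoid.trans' _ hvy (G.reach_twist B y)⟩
      · rw [← hc, G.edge_twist]
      · rw [← he]
        exact r.trans' hry (G.boundary_twist _ _)
  have h3 := Finset.card_erase_add_one hxS
  rw [← h3] at h1
  exact (Nat.not_even_iff_odd.2 h2.add_one) h1

/-- As both free sides now lie on one boundary component, the new relation coarsens the old. It does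
so strictly: `x` and `side x` were in different components of `(V, B)`. -/
theorem numBoundary_insert_lt [Finite V] [Finite F] (B : Set E) (x : F)
    (h : ¬ G.reachSetoid B (G.vert x) (G.vert (G.side x))) :
    G.numBoundary (insert (G.edge x) B) < G.numBoundary B := by
  set r := G.boundarySetoid (insert (G.edge x) B) with hr
  have hle : G.boundarySetoid B ≤ r := by
    intro u w huw
    rcases G.boundarySetoid_insert_le_glue B x huw with h' | ⟨h1, h2⟩
    · exact h'
    · have hx := G.boundary_insert_seg B x h
      have key : ∀ {y}, r y x ∨ r y (G.seg x) → r y x :=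
        fun hy => hy.elim id fun hy => r.trans' hy (r.symm' hx)
      exact r.trans' (key h1) (r.symm' (key h2))
  have hside : r x (G.side x) := by
    have := G.boundary_twist (insert (G.edge x) B) x
    rwa [G.twist_of_mem (Set.mem_insert _ _)] at this
  have := Setoid.card_quotient_lt_of_le hle (fun h' => h (G.reach_of_boundary h')) hside
  rw [numBoundary_eq, numBoundary_eq, ← hr]
  omega

theorem reachSetoid_insert_le_glue (B : Set E) (x : F) :
    G.reachSetoid (insert (G.edge x) B) ≤
      (G.reachSetoid B).glue (G.vert x) (G.vert (G.side x)) := by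
  refine G.reachSetoid_le fun y hy => ?_
  rcases hy with hy | hy
  · right
    have hx : ∀ z, G.edge z = G.edge x → G.reachSetoid B (G.vert z) (G.vert x) ∨
        G.reachSetoid B (G.vert z) (G.vert (G.side x)) := by
      intro z hz
      rcases G.corner_cases hz with rfl | rfl | rfl | rfl
      · exact Or.inl (Setoid.refl' _ _)
      · rw [G.vert_seg]; exact Or.inl (Setoid.refl' _ _)
      · exact Or.inr (Setoid.refl' _ _)
      · rw [G.vert_seg]; exact Or.inr (Setoid.refl' _ _)
    exact ⟨hx y hy, hx _ (by rw [G.edge_side, hy])⟩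
  · exact Or.inl (G.reach_side hy)

/-- If the edge has both ends in one component, `k` is unchanged and the new edge pays for at most
one new boundary component. Otherwise `2k` drops by at most `2`, compensated by one more edge and at
least one boundary component fewer. -/
theorem totalGenus_le_insert [Finite V] [Finite E] [Finite F] {B : Set E} {e : E} (he : e ∉ B) :
    G.totalGenus B ≤ G.totalGenus (insert e B) := by
  obtain ⟨x, rfl⟩ := G.edge_surjective e
  have hc : (insert (G.edge x) B).ncard = B.ncard + 1 := Set.ncard_insert_of_notMem he
  have hmono := G.reach_mono (Set.subset_insert (G.edge x) B)
  have hglue := G.reachSetoid_insert_le_glue B x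
  unfold totalGenus numComponents
  by_cases h : G.reachSetoid B (G.vert x) (G.vert (G.side x))
  · have h1 := G.numBoundary_insert_le B x
    have h2 : G.reachSetoid (insert (G.edge x) B) ≤ G.reachSetoid B := by
      intro u w huw
      rcases hglue huw with h' | ⟨h1, h2⟩
      · exact h'
      · have key : ∀ {y}, G.reachSetoid B y (G.vert x) ∨
            G.reachSetoid B y (G.vert (G.side x)) → G.reachSetoid B y (G.vert x) :=
          fun hy => hy.elim id fun hy => Setoid.trans' _ hy (Setoid.symm' _ h)
        exact Setoid.trans' _ (key h1) (Setoid.symm' _ (key h2))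
    have h3 := Setoid.card_quotient_le_of_le h2
    omega
  · have h1 := G.numBoundary_insert_lt B x h
    have h3 := Setoid.card_quotient_le_succ hmono hglue
    omega

end RibbonGraph

theorem Set.ncard_eq_sum_fiber {α β : Type*} [Finite α] [Fintype β] (s : Set α) (f : α → β) :
    s.ncard = ∑ b, {a | a ∈ s ∧ f a = b}.ncard := by
  classical
  have := Fintype.ofFinite α
  rw [Set.ncard_eq_toFinset_card',
    Finset.card_eq_sum_card_fiberwise (f := f) (t := Finset.univ) (fun _ _ => by simp)]
  refine Finset.sum_congr rfl fun b _ => ?_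
  rw [Set.ncard_eq_toFinset_card']
  congr 1
  ext a
  simp

/-! ### Components of spanning and induced ribbon subgraphs -/

namespace RibbonGraph

variable {V E F : Type*} (G : RibbonGraph V E F)

/-- The spanning ribbon subgraph `(V, B)`. -/
def spanning (B : Set E) : G.Subgraph where
  verts := Set.univ
  edges := B
  vert_mem _ _ := Set.mem_univ _

/-- The component of the spanning ribbon subgraph `(V, B)` given by a class of vertices. -/
def component (B : Set E) (q : Quotient (G.reachSetoid B)) : G.Subgraph where
  verts := {v | Quotient.mk _ v = q}
  edges := {e | e ∈ B ∧ ∃ x, G.edge x = e ∧ Quotient.mk _ (G.vert x) = q}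
  vert_mem := by
    rintro x ⟨hx, y, hy, rfl⟩
    refine Quotient.sound ?_
    have := G.reach_side (hy ▸ hx : G.edge y ∈ B)
    rcases G.corner_cases hy.symm with rfl | rfl | rfl | rfl
    · exact Setoid.refl' _ _
    · rw [G.vert_seg]
    · exact Setoid.symm' _ this
    · rw [G.vert_seg]; exact Setoid.symm' _ this

variable {G} {B : Set E}

namespace Subgraph

theorem Connected.reach {H : G.Subgraph} (h : H.Connected) {v w : V} (hv : v ∈ H.verts)
    (hw : w ∈ H.verts) : G.reachSetoid H.edges v w := h.2 v hv w hw

theorem mem_verts_of_reach {H : G.Subgraph} {v w : V} (h : G.reachSetoid H.edges v w)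
    (hv : v ∈ H.verts) : w ∈ H.verts := by
  induction h with
  | refl => exact hv
  | tail _ h _ =>
    obtain ⟨x, hx, -, rfl⟩ := h
    exact H.vert_mem _ (by rwa [G.edge_side])

end Subgraph

theorem edge_mem_component {q : Quotient (G.reachSetoid B)} {x : F} :
    G.edge x ∈ (G.component B q).edges ↔ G.edge x ∈ B ∧ Quotient.mk _ (G.vert x) = q :=
  ⟨fun h => ⟨h.1, (G.component B q).vert_mem x h⟩, fun h => ⟨h.1, x, rfl, h.2⟩⟩

theorem component_edges_subset (q : Quotient (G.reachSetoid B)) :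
    (G.component B q).edges ⊆ B := fun _ h => h.1

theorem reach_component {v w : V} (h : G.reachSetoid B v w) :
    G.reachSetoid (G.component B (Quotient.mk _ v)).edges v w := by
  induction h with
  | refl => exact Setoid.refl' _ _
  | tail h1 h2 ih =>
    obtain ⟨x, hx, rfl, rfl⟩ := h2
    refine Setoid.trans' _ ih (G.reach_side (edge_mem_component.2 ⟨hx, ?_⟩))
    exact Quotient.sound (Setoid.symm' _ h1)

theorem component_connected (q : Quotient (G.reachSetoid B)) : (G.component B q).Connected := by
  refine ⟨?_, ?_⟩
  · induction q using Quotient.inductionOn with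
    | h v => exact ⟨v, rfl⟩
  · rintro v rfl w hw
    exact reach_component (Setoid.symm' _ (Quotient.exact hw))

theorem exists_le_component {L : G.Subgraph} (hL : L.Connected) (h : L.edges ⊆ B) :
    ∃ q, L ≤ G.component B q := by
  obtain ⟨v, hv⟩ := hL.1
  have hvert : ∀ w ∈ L.verts, Quotient.mk (G.reachSetoid B) w = Quotient.mk _ v :=
    fun w hw => Quotient.sound (G.reach_mono h (hL.reach hw hv))
  refine ⟨Quotient.mk _ v, hvert, fun e he => ?_⟩
  obtain ⟨x, rfl⟩ := G.edge_surjective e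
  exact edge_mem_component.2 ⟨h he, hvert _ (L.vert_mem x he)⟩

theorem eq_of_component_le {q q' : Quotient (G.reachSetoid B)}
    (h : G.component B q ≤ G.component B q') : q = q' := by
  obtain ⟨v, hv⟩ := (component_connected q).1
  exact Eq.trans (Eq.symm hv) (h.1 hv)

theorem component_injective : Function.Injective (G.component B) :=
  fun _ _ h => eq_of_component_le h.le

theorem isComponent_spanning_iff {K : G.Subgraph} :
    (G.spanning B).IsComponent K ↔ ∃ q, K = G.component B q := by
  have hle : ∀ q, G.component B q ≤ G.spanning B :=
    fun q => ⟨Set.subset_univ _, component_edges_subset q⟩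
  constructor
  · rintro ⟨⟨h1, h2⟩, h3⟩
    obtain ⟨q, hq⟩ := exists_le_component h2 h1.2
    exact ⟨q, le_antisymm hq (h3 ⟨hle q, component_connected q⟩ hq)⟩
  · rintro ⟨q, rfl⟩
    refine ⟨⟨hle q, component_connected q⟩, ?_⟩
    rintro L ⟨h1, h2⟩ h3
    obtain ⟨q', hq'⟩ := exists_le_component h2 h1.2
    obtain rfl := eq_of_component_le (h3.trans hq')
    exact hq'

theorem component_le_induced {q : Quotient (G.reachSetoid B)}
    (h : (G.component B q).edges.Nonempty) : G.component B q ≤ G.induced B := by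
  obtain ⟨e, he⟩ := h
  obtain ⟨y, rfl⟩ := G.edge_surjective e
  refine ⟨fun v hv => ?_, component_edges_subset q⟩
  have hr : G.reachSetoid B v (G.vert y) :=
    Quotient.exact (Eq.trans hv (edge_mem_component.1 he).2.symm)
  rcases Relation.ReflTransGen.cases_head hr with rfl | ⟨_, ⟨x, hx, rfl, -⟩, -⟩
  · exact ⟨y, he.1, rfl⟩
  · exact ⟨x, hx, rfl⟩

/-- Passing from `(V, B)` to `G|_B` discards exactly the components that are isolated vertices. -/
theorem isComponent_induced_iff {K : G.Subgraph} :
    (G.induced B).IsComponent K ↔ ∃ q, K = G.component B q ∧ K.edges.Nonempty := by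
  constructor
  · rintro ⟨⟨h1, h2⟩, h3⟩
    obtain ⟨q, hq⟩ := exists_le_component h2 h1.2
    obtain ⟨v, hv⟩ := h2.1
    obtain ⟨x, hx, rfl⟩ := h1.1 hv
    have hne : (G.component B q).edges.Nonempty :=
      ⟨_, edge_mem_component.2 ⟨hx, hq.1 hv⟩⟩
    have : K = G.component B q :=
      le_antisymm hq (h3 ⟨component_le_induced hne, component_connected q⟩ hq)
    exact ⟨q, this, this ▸ hne⟩
  · rintro ⟨q, rfl, hne⟩
    refine ⟨⟨component_le_induced hne, component_connected q⟩, ?_⟩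
    rintro L ⟨h1, h2⟩ h3
    obtain ⟨q', hq'⟩ := exists_le_component h2 h1.2
    obtain rfl := eq_of_component_le (h3.trans hq')
    exact hq'

/-! ### Counting over components -/

theorem sum_ncard_component_verts [Finite V] [Fintype (Quotient (G.reachSetoid B))] :
    ∑ q, (G.component B q).verts.ncard = Nat.card V := by
  rw [← Set.ncard_univ, Set.ncard_eq_sum_fiber Set.univ (Quotient.mk (G.reachSetoid B))]
  simp [component]

theorem sum_ncard_component_edges [Finite E] [Fintype (Quotient (G.reachSetoid B))] :
    ∑ q, (G.component B q).edges.ncard = B.ncard := by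
  choose c hc using G.edge_surjective
  rw [Set.ncard_eq_sum_fiber B fun e => Quotient.mk (G.reachSetoid B) (G.vert (c e))]
  refine Finset.sum_congr rfl fun q _ => ?_
  congr 1
  ext e
  nth_rw 1 [← hc e]
  rw [edge_mem_component, hc e]
  rfl

theorem boundarySetoid_congr_on {B B' : Set E} (S : Set F)
    (ht : ∀ u, u ∈ S ↔ G.twist B u ∈ S) (hg : ∀ u, u ∈ S ↔ G.gap u ∈ S)
    (h : ∀ u ∈ S, G.twist B u = G.twist B' u) {x y : F} (hx : x ∈ S)
    (hxy : G.boundarySetoid B x y) : G.boundarySetoid B' x y := by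
  -- Membership in `S` is carried along in both directions, so that the conditional relation is
  -- symmetric and transitive.
  let s : Setoid F :=
    { r := fun u w => (u ∈ S ↔ w ∈ S) ∧ (u ∈ S → G.boundarySetoid B' u w)
      iseqv := by
        refine ⟨fun u => ⟨Iff.rfl, fun _ => Setoid.refl' _ u⟩, ?_, ?_⟩
        · exact fun h => ⟨h.1.symm, fun hy => Setoid.symm' _ (h.2 (h.1.2 hy))⟩
        · exact fun h h' => ⟨h.1.trans h'.1,
            fun hu => Setoid.trans' _ (h.2 hu) (h'.2 (h.1.1 hu))⟩ }
  have hs : G.boundarySetoid B ≤ s :=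
    G.boundarySetoid_le (fun u => ⟨ht u, fun hu => h u hu ▸ G.boundary_twist B' u⟩)
      fun u => ⟨hg u, fun _ => G.boundary_gap B' u⟩
  exact (hs hxy).2 hx

/-- Edges of the other components have no corner on `q`, so removing them does not change `twist`
there. -/
theorem boundarySetoid_component_iff {q : Quotient (G.reachSetoid B)} {x y : F}
    (hx : G.vert x ∈ (G.component B q).verts) :
    G.boundarySetoid (G.component B q).edges x y ↔ G.boundarySetoid B x y := by
  let S : Set F := {u | Quotient.mk (G.reachSetoid B) (G.vert u) = q}
  have ht : ∀ B' ⊆ B, ∀ u, u ∈ S ↔ G.twist B' u ∈ S := by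
    intro B' hB' u
    have : Quotient.mk (G.reachSetoid B) (G.vert u) =
        Quotient.mk (G.reachSetoid B) (G.vert (G.twist B' u)) :=
      Quotient.sound (G.reach_mono hB' (G.reach_twist B' u))
    simp only [S, Set.mem_ofPred_eq, this]
  have hg : ∀ u, u ∈ S ↔ G.gap u ∈ S := fun u => by simp only [S, Set.mem_ofPred_eq, G.vert_gap]
  have h : ∀ u ∈ S, G.twist (G.component B q).edges u = G.twist B u :=
    fun u hu => G.twist_congr (edge_mem_component.trans (and_iff_left hu))
  exact ⟨boundarySetoid_congr_on S (ht _ (component_edges_subset q)) hg h hx,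
    boundarySetoid_congr_on S (ht B le_rfl) hg (fun u hu => (h u hu).symm) hx⟩

variable (G B) in
/-- The component of `(V, B)` on which a boundary component of `(V, B)` lies. -/
def boundaryToComponent : G.BoundaryComponent B → Quotient (G.reachSetoid B) :=
  Sum.elim (Quotient.lift (fun x => Quotient.mk _ (G.vert x))
    fun _ _ h => Quotient.sound (G.reach_of_boundary h)) fun v => Quotient.mk _ v.1

theorem ncard_boundary_component (q : Quotient (G.reachSetoid B)) :
    (G.component B q).boundary.ncard = {b | G.boundaryToComponent B b = q}.ncard := by
  -- A boundary component stays within one component, so any representative decides where it lies.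
  have hout : ∀ (b : Quotient (G.boundarySetoid (G.component B q).edges)),
      (Sum.inl b ∈ (G.component B q).boundary ↔
        G.vert b.out ∈ (G.component B q).verts) := by
    intro b
    constructor
    · rintro (⟨x, hx, hb⟩ | ⟨v, -, hb⟩)
      · obtain rfl := Sum.inl.inj hb
        exact Subgraph.mem_verts_of_reach
          (G.reach_of_boundary (Setoid.symm' _ (Quotient.mk_out x))) hx
      · cases hb
    · exact fun h => Or.inl ⟨b.out, h, by rw [Quotient.out_eq]⟩
  have hinr : ∀ v : G.BareVertex, (Sum.inr v ∈ (G.component B q).boundary ↔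
      v.1 ∈ (G.component B q).verts) := by
    intro v
    constructor
    · rintro (⟨x, hx, hb⟩ | ⟨w, hw, hb⟩)
      · cases hb
      · obtain rfl := Sum.inr.inj hb
        exact hw
    · exact fun h => Or.inr ⟨v, h, rfl⟩
  refine Set.ncard_congr
    (fun b _ => Sum.elim (fun p => Sum.inl (Quotient.mk (G.boundarySetoid B) p.out)) Sum.inr b)
    ?_ ?_ ?_
  · rintro (b | v) hb
    · exact (hout b).1 hb
    · exact (hinr v).1 hb
  · rintro (b | v) (b' | v') hb hb' h
    · have h' : G.boundarySetoid B b.out b'.out := Quotient.exact (Sum.inl.inj h)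
      rw [← boundarySetoid_component_iff ((hout b).1 hb)] at h'
      rw [← Quotient.out_eq b, ← Quotient.out_eq b']
      exact congrArg Sum.inl (Quotient.sound h')
    · cases h
    · cases h
    · obtain rfl := Sum.inr.inj h
      rfl
  · rintro (b | v) hb
    · induction b using Quotient.inductionOn with | h x =>
      have hx : G.vert x ∈ (G.component B q).verts := hb
      refine ⟨Sum.inl (Quotient.mk _ x), Or.inl ⟨x, hx, rfl⟩, congrArg Sum.inl ?_⟩
      refine Quotient.sound (Setoid.symm' _ ((boundarySetoid_component_iff hx).1 ?_))
      exact Setoid.symm' _ (Quotient.mk_out x)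
    · exact ⟨Sum.inr v, (hinr v).2 hb, rfl⟩

theorem sum_ncard_component_boundary [Finite V] [Finite F]
    [Fintype (Quotient (G.reachSetoid B))] :
    ∑ q, (G.component B q).boundary.ncard = G.numBoundary B := by
  rw [numBoundary, ← Set.ncard_univ, Set.ncard_eq_sum_fiber Set.univ (G.boundaryToComponent B)]
  simp [ncard_boundary_component]

theorem totalGenus_eq_sum [Finite V] [Finite E] [Finite F]
    [Fintype (Quotient (G.reachSetoid B))] :
    G.totalGenus B = ∑ q, (2 - (G.component B q).cappedEulerChar) := by
  simp only [Subgraph.cappedEulerChar, Finset.sum_sub_distrib, Finset.sum_add_distrib,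
    ← Nat.cast_sum, sum_ncard_component_verts, sum_ncard_component_edges,
    sum_ncard_component_boundary, Finset.sum_const, Finset.card_univ, totalGenus, numComponents,
    Nat.card_eq_fintype_card (α := Quotient _), nsmul_eq_mul]
  ring

/-! ### Edgeless ribbon graphs and nonnegativity of the Euler genus -/

theorem boundarySetoid_empty_iff {x y : F} : G.boundarySetoid ∅ x y ↔ G.vert x = G.vert y := by
  rw [G.vert_eq_iff]
  change Relation.EqvGen _ x y ↔ _
  simp only [G.twist_of_notMem (Set.notMem_empty _)]

namespace Subgraph

theorem ncard_boundary_of_edges_eq_empty (H : G.Subgraph) (h : H.edges = ∅) :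
    H.boundary.ncard = H.verts.ncard := by
  obtain ⟨verts, edges, hm⟩ := H
  obtain rfl : edges = ∅ := h
  let τ : G.BoundaryComponent ∅ → V :=
    Sum.elim (Quotient.lift G.vert fun _ _ h => boundarySetoid_empty_iff.1 h) Subtype.val
  refine Set.ncard_congr (fun b _ => τ b) ?_ ?_ ?_
  · rintro _ (⟨x, hx, rfl⟩ | ⟨v, hv, rfl⟩)
    · exact hx
    · exact hv
  · rintro (b | v) (b' | v') - - hb
    · induction b using Quotient.inductionOn with | h x =>
      induction b' using Quotient.inductionOn with | h x' =>
      exact congrArg Sum.inl (Quotient.sound (boundarySetoid_empty_iff.2 hb))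
    · induction b using Quotient.inductionOn with | h x =>
      exact absurd hb (v'.2 x)
    · induction b' using Quotient.inductionOn with | h x =>
      exact absurd hb.symm (v.2 x)
    · exact congrArg Sum.inr (Subtype.ext hb)
  · intro v hv
    by_cases h : ∃ x, G.vert x = v
    · obtain ⟨x, rfl⟩ := h
      exact ⟨_, Or.inl ⟨x, hv, rfl⟩, rfl⟩
    · exact ⟨_, Or.inr ⟨⟨v, not_exists.1 h⟩, hv, rfl⟩, rfl⟩

theorem Connected.ncard_verts_of_edges_eq_empty {H : G.Subgraph} (hc : H.Connected)
    (h : H.edges = ∅) : H.verts.ncard = 1 := by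
  obtain ⟨v, hv⟩ := hc.1
  rw [Set.ncard_eq_one]
  refine ⟨v, Set.eq_singleton_iff_unique_mem.2 ⟨hv, fun w hw => ?_⟩⟩
  rcases Relation.ReflTransGen.cases_head (hc.2 w hw v hv) with rfl | ⟨_, ⟨x, hx, -⟩, -⟩
  · rfl
  · simp [h] at hx

theorem Connected.cappedEulerChar_of_edges_eq_empty {H : G.Subgraph} (hc : H.Connected)
    (h : H.edges = ∅) : H.cappedEulerChar = 2 := by
  rw [cappedEulerChar, H.ncard_boundary_of_edges_eq_empty h, hc.ncard_verts_of_edges_eq_empty h, h]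
  simp

end Subgraph

/-- Build `B` up edge by edge. At the start every component is a single vertex, which caps off to a
sphere. -/
theorem totalGenus_nonneg [Finite V] [Finite E] [Finite F] (B : Set E) : 0 ≤ G.totalGenus B := by
  classical
  induction B, B.toFinite using Set.Finite.induction_on with
  | empty =>
    have := Fintype.ofFinite (Quotient (G.reachSetoid ∅))
    rw [totalGenus_eq_sum]
    refine Finset.sum_nonneg fun q _ => ?_
    rw [(component_connected q).cappedEulerChar_of_edges_eq_empty
      (Set.subset_empty_iff.1 (component_edges_subset q))]
    norm_num
  | insert he _ ih => exact ih.trans (G.totalGenus_le_insert he)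

namespace Subgraph

/-- `K` is itself a component of `(V, K.edges)`; the others are isolated vertices and contribute
`0`. -/
theorem Connected.two_sub_cappedEulerChar [Finite V] [Finite E] [Finite F] {K : G.Subgraph}
    (hK : K.Connected) : 2 - K.cappedEulerChar = G.totalGenus K.edges := by
  classical
  have := Fintype.ofFinite (Quotient (G.reachSetoid K.edges))
  obtain ⟨q, hq⟩ := exists_le_component hK (subset_refl K.edges)
  obtain ⟨v, hv⟩ := hK.1
  have hKq : K = G.component K.edges q := by
    refine le_antisymm hq ⟨fun w hw => ?_, component_edges_subset q⟩
    exact mem_verts_of_reach (Quotient.exact (Eq.trans (hq.1 hv) (Eq.symm hw))) hv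
  rw [totalGenus_eq_sum, Finset.sum_eq_single q, ← hKq]
  · intro q' _ hne
    rw [(component_connected q').cappedEulerChar_of_edges_eq_empty, sub_self]
    refine Set.eq_empty_iff_forall_notMem.2 fun e he => hne ?_
    obtain ⟨x, rfl⟩ := G.edge_surjective e
    rw [← (edge_mem_component.1 he).2]
    exact hq.1 (K.vert_mem x he.1)
  · exact fun h => absurd (Finset.mem_univ q) h

/-- The Euler characteristic of a closed connected surface is at most two. -/
theorem Connected.cappedEulerChar_le_two [Finite V] [Finite E] [Finite F] {K : G.Subgraph}
    (hK : K.Connected) : K.cappedEulerChar ≤ 2 := by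
  have := hK.two_sub_cappedEulerChar
  have := G.totalGenus_nonneg K.edges
  omega

theorem eulerGenus_eq (H : G.Subgraph) : H.eulerGenus = 2 - H.cappedEulerChar := by
  unfold eulerGenus genus
  split_ifs
  · ring
  · rfl

theorem isPlane_iff {H : G.Subgraph} : H.IsPlane ↔ H.Connected ∧ 2 - H.cappedEulerChar = 0 := by
  rw [IsPlane, eulerGenus_eq]
  norm_cast

theorem isRP2_iff {H : G.Subgraph} : H.IsRP2 ↔ H.Connected ∧ 2 - H.cappedEulerChar = 1 := by
  rw [IsRP2, eulerGenus_eq]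
  norm_cast

end Subgraph

end RibbonGraph

theorem Finset.sum_int_eq_one_iff {α : Type*} {s : Finset α} {f : α → ℤ}
    (hf : ∀ a ∈ s, 0 ≤ f a) :
    ∑ a ∈ s, f a = 1 ↔ ∃ a ∈ s, f a = 1 ∧ ∀ b ∈ s, b ≠ a → f b = 0 := by
  classical
  constructor
  · intro h
    obtain ⟨a, ha, hne⟩ : ∃ a ∈ s, f a ≠ 0 := Finset.exists_ne_zero_of_sum_ne_zero (by omega)
    have hpos := hf a ha
    have hnn : ∀ b ∈ s.erase a, 0 ≤ f b := fun b hb => hf b (Finset.mem_of_mem_erase hb)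
    have hrest := Finset.sum_nonneg hnn
    have hsum := Finset.add_sum_erase s f ha
    have h0 : ∑ b ∈ s.erase a, f b = 0 := by omega
    refine ⟨a, ha, by omega, fun b hb hba => ?_⟩
    exact (Finset.sum_eq_zero_iff_of_nonneg hnn).1 h0 b (Finset.mem_erase.2 ⟨hba, hb⟩)
  · rintro ⟨a, ha, h1, h0⟩
    rw [Finset.sum_eq_single_of_mem a ha h0, h1]

namespace RibbonGraph

variable {V E F : Type*} (G : RibbonGraph V E F) (A B : Set E)

/-! ### The Euler genus of a partial dual -/

theorem card_bareVertex_partialDual :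
    Nat.card (G.partialDual A).BareVertex = Nat.card G.BareVertex := by
  refine (Nat.card_congr (Equiv.ofBijective
    (fun v : G.BareVertex => (⟨Sum.inr v, fun x h => by cases h⟩ : (G.partialDual A).BareVertex))
    ⟨fun v w h => ?_, ?_⟩)).symm
  · exact Sum.inr.inj (congrArg Subtype.val h)
  · rintro ⟨b | v, hb⟩
    · induction b using Quotient.inductionOn with | h x =>
      exact absurd rfl (hb x)
    · exact ⟨v, rfl⟩

/-- The free sides of the edges of `G^A` are by construction the arcs `twist Aᶜ`. -/
theorem boundarySetoid_partialDual_univ :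
    (G.partialDual A).boundarySetoid Set.univ = G.boundarySetoid Aᶜ := by
  have h : ∀ x, (G.partialDual A).twist Set.univ x = G.twist Aᶜ x :=
    fun x => (G.partialDual A).twist_of_mem (Set.mem_univ _)
  refine le_antisymm ?_ ?_
  · refine boundarySetoid_le _ (fun x => ?_) (G.boundary_gap Aᶜ)
    rw [h]
    exact G.boundary_twist _ _
  · refine boundarySetoid_le _ (fun x => ?_) ((G.partialDual A).boundary_gap Set.univ)
    rw [← h]
    exact boundary_twist _ _ _

theorem boundary_full : G.full.boundary = Set.univ := by
  refine Set.eq_univ_of_forall ?_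
  rintro (b | v)
  · induction b using Quotient.inductionOn with | h x =>
    exact Or.inl ⟨x, Set.mem_univ _, rfl⟩
  · exact Or.inr ⟨v, Set.mem_univ _, rfl⟩

theorem cappedEulerChar_partialDual [Finite V] [Finite F] :
    (G.partialDual A).full.cappedEulerChar =
      G.numBoundary A + G.numBoundary Aᶜ - Nat.card E := by
  have h : Nat.card ((G.partialDual A).BoundaryComponent Set.univ) = G.numBoundary Aᶜ := by
    rw [numBoundary_eq, Nat.card_sum, boundarySetoid_partialDual_univ,
      card_bareVertex_partialDual]
  rw [Subgraph.cappedEulerChar, boundary_full, Set.ncard_univ]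
  change ((Set.univ : Set (G.BoundaryComponent A)).ncard : ℤ) - (Set.univ : Set E).ncard +
    (Nat.card ((G.partialDual A).BoundaryComponent Set.univ) : ℤ) = _
  rw [h, Set.ncard_univ, Set.ncard_univ]
  simp only [numBoundary]
  ring

/-- The cycle rank of the graph whose vertices are the components of `(V, A)` and of `(V, Aᶜ)`
and whose edges are the vertices of `G`, if it is connected. -/
noncomputable def cycleRank : ℤ :=
  1 + Nat.card V - G.numComponents A - G.numComponents Aᶜ

/-- The boundary counts cancel against those in `γ(A) + γ(Aᶜ)`, and `|A| + |Aᶜ| = |E|`; what remains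
is twice the cycle rank. -/
theorem two_sub_cappedEulerChar_partialDual [Finite V] [Finite E] [Finite F] :
    2 - (G.partialDual A).full.cappedEulerChar =
      G.totalGenus A + G.totalGenus Aᶜ + 2 * G.cycleRank A := by
  have h := Set.ncard_add_ncard_compl A
  rw [cappedEulerChar_partialDual, totalGenus, totalGenus, cycleRank]
  omega

variable {G A B}

theorem Connected.eq_of_bareVertex (hG : G.Connected) (v : G.BareVertex) (w : V) :
    w = v.1 := by
  rcases Relation.ReflTransGen.cases_tail (hG.2 w (Set.mem_univ _) v.1 (Set.mem_univ _)) with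
    h | ⟨_, -, x, -, -, hx⟩
  · exact h.symm
  · exact absurd hx (v.2 _)

/-- Every arc of `G` either stays on one vertex of `G^A` or leads along an edge of `G^A`, so paths
in `G` can be followed in `G^A`. A vertex meeting no edge must be all of `G`. -/
theorem Connected.partialDual (hG : G.Connected) (A : Set E) : (G.partialDual A).Connected := by
  set D := G.partialDual A with hD
  have hedge : ∀ x, D.reachSetoid Set.univ (D.vert x) (D.vert (G.twist Aᶜ x)) := fun x =>
    D.reach_side (Set.mem_univ (D.edge x))
  have hsame : ∀ x, D.reachSetoid Set.univ (D.vert x) (D.vert (G.twist A x)) := by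
    intro x
    have : D.vert (G.twist A x) = D.vert x := D.vert_seg x
    rw [this]
  have hgap : ∀ x, D.reachSetoid Set.univ (D.vert x) (D.vert (G.gap x)) := by
    intro x
    have : D.vert (G.gap x) = D.vert x := D.vert_gap x
    rw [this]
  have hside : ∀ x, D.reachSetoid Set.univ (D.vert x) (D.vert (G.side x)) := by
    intro x
    by_cases h : G.edge x ∈ A
    · rw [← G.twist_of_mem h]; exact hsame x
    · rw [← G.twist_of_mem (B := Aᶜ) h]; exact hedge x
  have hseg : ∀ x, D.reachSetoid Set.univ (D.vert x) (D.vert (G.seg x)) := by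
    intro x
    by_cases h : G.edge x ∈ A
    · rw [← G.twist_of_notMem (B := Aᶜ) (fun h' => h' h)]; exact hedge x
    · rw [← G.twist_of_notMem h]; exact hsame x
  have hvert : ∀ x y, G.vert x = G.vert y → D.reachSetoid Set.univ (D.vert x) (D.vert y) := by
    intro x y h
    have : Relation.EqvGen.setoid (fun u w => w = G.seg u ∨ w = G.gap u) ≤
        (D.reachSetoid Set.univ).comap D.vert := by
      refine Setoid.eqvGen_le ?_
      rintro u w (rfl | rfl)
      · exact hseg u
      · exact hgap u
    exact this ((G.vert_eq_iff x y).1 h)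
  have key : ∀ {v w : V}, G.reachSetoid Set.univ v w → ∀ x y, G.vert x = v → G.vert y = w →
      D.reachSetoid Set.univ (D.vert x) (D.vert y) := by
    intro v w h
    induction h with
    | refl => exact fun x y hx hy => hvert x y (hx.trans hy.symm)
    | tail _ h ih =>
      obtain ⟨z, -, rfl, rfl⟩ := h
      exact fun x y hx hy => Setoid.trans' _ (Setoid.trans' _ (ih x z hx rfl) (hside z))
        (hvert _ _ hy.symm)
  refine ⟨?_, ?_⟩
  · obtain ⟨v, -⟩ := hG.1
    by_cases h : ∃ x, G.vert x = v
    · obtain ⟨x, rfl⟩ := h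
      exact ⟨D.vert x, Set.mem_univ _⟩
    · exact ⟨Sum.inr ⟨v, not_exists.1 h⟩, Set.mem_univ _⟩
  · rintro (b | v) - (b' | v') -
    · induction b using Quotient.inductionOn with | h x =>
      induction b' using Quotient.inductionOn with | h y =>
      exact key (hG.2 (G.vert x) (Set.mem_univ _) (G.vert y) (Set.mem_univ _)) x y rfl rfl
    · induction b using Quotient.inductionOn with | h x =>
      exact absurd (hG.eq_of_bareVertex v' (G.vert x)) (v'.2 x)
    · induction b' using Quotient.inductionOn with | h x =>
      exact absurd (hG.eq_of_bareVertex v (G.vert x)) (v.2 x)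
    · obtain rfl : v = v' := Subtype.ext (hG.eq_of_bareVertex v' v.1)
      exact .refl

/-! ### The components of `G|_A` and `G|_{Aᶜ}` -/

theorem edges_nonempty_of_isComponent_induced {K : G.Subgraph}
    (h : (G.induced B).IsComponent K) : K.edges.Nonempty := by
  obtain ⟨q, -, h⟩ := isComponent_induced_iff.1 h
  exact h

theorem exists_isComponent_induced {x : F} (h : G.edge x ∈ B) :
    ∃ K, (G.induced B).IsComponent K ∧ G.edge x ∈ K.edges :=
  have hx : G.edge x ∈ (G.component B (Quotient.mk _ (G.vert x))).edges :=
    edge_mem_component.2 ⟨h, rfl⟩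
  ⟨_, isComponent_induced_iff.2 ⟨_, rfl, _, hx⟩, hx⟩

theorem eq_of_isComponent_induced {K K' : G.Subgraph} {v : V}
    (h : (G.induced B).IsComponent K) (h' : (G.induced B).IsComponent K') (hv : v ∈ K.verts)
    (hv' : v ∈ K'.verts) : K = K' := by
  obtain ⟨q, rfl, -⟩ := isComponent_induced_iff.1 h
  obtain ⟨q', rfl, -⟩ := isComponent_induced_iff.1 h'
  rw [Eq.trans (Eq.symm hv) hv']

instance [Finite V] [Finite E] : Finite G.Subgraph :=
  Finite.of_injective (fun H : G.Subgraph => (H.verts, H.edges)) fun _ _ h =>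
    Subgraph.ext (congrArg Prod.fst h) (congrArg Prod.snd h)

variable (G B) in
/-- The components of `G|_B`. -/
noncomputable def inducedComponents [Finite V] [Finite E] : Finset G.Subgraph :=
  (Set.toFinite {K | (G.induced B).IsComponent K}).toFinset

section

variable [Finite V] [Finite E]

theorem mem_inducedComponents {K : G.Subgraph} :
    K ∈ G.inducedComponents B ↔ (G.induced B).IsComponent K := by
  simp [inducedComponents]

/-- Isolated vertices of `(V, B)` are not components of `G|_B`; a weight vanishing on edgeless
graphs does not see the difference. -/
theorem sum_inducedComponents [Fintype (Quotient (G.reachSetoid B))] (g : G.Subgraph → ℤ)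
    (hg : ∀ K : G.Subgraph, K.Connected → K.edges = ∅ → g K = 0) :
    ∑ K ∈ G.inducedComponents B, g K = ∑ q, g (G.component B q) := by
  classical
  have h : G.inducedComponents B =
      (Finset.univ.filter fun q => (G.component B q).edges.Nonempty).image (G.component B) := by
    ext K
    rw [mem_inducedComponents, isComponent_induced_iff, Finset.mem_image]
    constructor
    · rintro ⟨q, rfl, hq⟩
      exact ⟨q, by simpa using hq, rfl⟩
    · rintro ⟨q, hq, rfl⟩
      exact ⟨q, rfl, by simpa using hq⟩
  rw [h, Finset.sum_image component_injective.injOn]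
  refine Finset.sum_filter_of_ne fun q _ hq => ?_
  by_contra hne
  exact hq (hg _ (component_connected q) (Set.not_nonempty_iff_eq_empty.1 hne))

theorem sum_inducedComponents_genus [Finite F] :
    ∑ K ∈ G.inducedComponents B, (2 - K.cappedEulerChar) = G.totalGenus B := by
  have := Fintype.ofFinite (Quotient (G.reachSetoid B))
  rw [sum_inducedComponents, totalGenus_eq_sum]
  intro K hK h
  rw [hK.cappedEulerChar_of_edges_eq_empty h, sub_self]

theorem sum_inducedComponents_verts :
    ∑ K ∈ G.inducedComponents B, ((K.verts.ncard : ℤ) - 1) =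
      Nat.card V - G.numComponents B := by
  have := Fintype.ofFinite (Quotient (G.reachSetoid B))
  rw [sum_inducedComponents, Finset.sum_sub_distrib, ← Nat.cast_sum, sum_ncard_component_verts,
    numComponents, Nat.card_eq_fintype_card (α := Quotient _)]
  · simp
  · intro K hK h
    rw [hK.ncard_verts_of_edges_eq_empty h]
    rfl

variable (G A) in
open Classical in
/-- The components of `G|_A` and of `G|_{Aᶜ}`. -/
noncomputable def pieces : Finset G.Subgraph := G.inducedComponents A ∪ G.inducedComponents Aᶜ

theorem mem_pieces {K : G.Subgraph} : K ∈ G.pieces A ↔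
    (G.induced A).IsComponent K ∨ (G.induced Aᶜ).IsComponent K := by
  simp [pieces, mem_inducedComponents]

theorem sum_pieces (g : G.Subgraph → ℤ) :
    ∑ K ∈ G.pieces A, g K =
      ∑ K ∈ G.inducedComponents A, g K + ∑ K ∈ G.inducedComponents Aᶜ, g K := by
  classical
  rw [pieces]
  convert Finset.sum_union ?_
  refine Finset.disjoint_left.2 fun K hK hK' => ?_
  rw [mem_inducedComponents] at hK hK'
  obtain ⟨e, he⟩ := edges_nonempty_of_isComponent_induced hK
  exact hK'.1.1.2 he (hK.1.1.2 he)

theorem sum_pieces_genus [Finite F] :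
    ∑ K ∈ G.pieces A, (2 - K.cappedEulerChar) = G.totalGenus A + G.totalGenus Aᶜ := by
  rw [sum_pieces, sum_inducedComponents_genus, sum_inducedComponents_genus]

theorem sum_pieces_verts :
    ∑ K ∈ G.pieces A, ((K.verts.ncard : ℤ) - 1) = G.cycleRank A + Nat.card V - 1 := by
  rw [sum_pieces, sum_inducedComponents_verts, sum_inducedComponents_verts, cycleRank]
  ring

theorem pieces_connected {K : G.Subgraph} (h : K ∈ G.pieces A) : K.Connected :=
  (mem_pieces.1 h).elim (fun h => h.1.2) fun h => h.1.2

theorem pieces_edges_nonempty {K : G.Subgraph} (h : K ∈ G.pieces A) : K.edges.Nonempty :=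
  (mem_pieces.1 h).elim edges_nonempty_of_isComponent_induced
    edges_nonempty_of_isComponent_induced

theorem exists_mem_pieces (A : Set E) (x : F) : ∃ K ∈ G.pieces A, G.edge x ∈ K.edges := by
  by_cases h : G.edge x ∈ A
  · obtain ⟨K, hK, hx⟩ := exists_isComponent_induced h
    exact ⟨K, mem_pieces.2 (Or.inl hK), hx⟩
  · obtain ⟨K, hK, hx⟩ := exists_isComponent_induced (B := Aᶜ) h
    exact ⟨K, mem_pieces.2 (Or.inr hK), hx⟩

theorem pieces_edges_disjoint {K K' : G.Subgraph} (h : K ∈ G.pieces A) (h' : K' ∈ G.pieces A)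
    (hne : K ≠ K') : K.edges ∩ K'.edges = ∅ := by
  refine Set.eq_empty_iff_forall_notMem.2 ?_
  rintro e ⟨he, he'⟩
  obtain ⟨x, rfl⟩ := G.edge_surjective e
  rcases mem_pieces.1 h with h | h <;> rcases mem_pieces.1 h' with h' | h'
  · exact hne (eq_of_isComponent_induced h h' (K.vert_mem x he) (K'.vert_mem x he'))
  · exact h'.1.1.2 he' (h.1.1.2 he)
  · exact h.1.1.2 he (h'.1.1.2 he')
  · exact hne (eq_of_isComponent_induced h h' (K.vert_mem x he) (K'.vert_mem x he'))

end

end RibbonGraph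

/-! ### Assembling the pieces one after the other -/

namespace RibbonGraph

variable {V E F : Type*} {G : RibbonGraph V E F} {A : Set E}

namespace Subgraph

/-- The union of two ribbon subgraphs. -/
def union (H K : G.Subgraph) : G.Subgraph where
  verts := H.verts ∪ K.verts
  edges := H.edges ∪ K.edges
  vert_mem x hx := hx.imp (H.vert_mem x) (K.vert_mem x)

theorem Connected.union {H K : G.Subgraph} (hH : H.Connected) (hK : K.Connected)
    (h : (H.verts ∩ K.verts).Nonempty) : (H.union K).Connected := by
  obtain ⟨c, hcH, hcK⟩ := h
  have key : ∀ v ∈ (H.union K).verts, G.reachSetoid (H.union K).edges v c := by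
    rintro v (hv | hv)
    · exact G.reach_mono Set.subset_union_left (hH.reach hv hcH)
    · exact G.reach_mono Set.subset_union_right (hK.reach hv hcK)
  exact ⟨⟨c, Or.inl hcH⟩, fun v hv w hw => Setoid.trans' _ (key v hv) (Setoid.symm' _ (key w hw))⟩

/-- In a sequence of 1-sums, every summand contributes all but one of its vertices. -/
theorem IsOneSumSeq.ncard_verts [Finite V] {R : G.Subgraph → G.Subgraph → Prop}
    {l : List G.Subgraph} {K : G.Subgraph} (h : IsOneSumSeq R l K) :
    (K.verts.ncard : ℤ) = 1 + (l.map fun H => (H.verts.ncard : ℤ) - 1).sum := by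
  induction h with
  | single => simp
  | snoc l K L H H' v _ hs _ _ _ ih =>
    have hinter : (K.verts ∩ H.verts).ncard = 1 := by
      rw [hs.2.2.2.2.2.2.1, Set.ncard_singleton]
    have := Set.ncard_union_add_ncard_inter K.verts H.verts
    rw [hs.2.2.2.2.1, List.map_append, List.sum_append]
    simp only [List.map_cons, List.map_nil, List.sum_cons, List.sum_nil]
    omega

end Subgraph

theorem cycleRank_compl (A : Set E) : G.cycleRank Aᶜ = G.cycleRank A := by
  rw [cycleRank, cycleRank, compl_compl]
  ring

theorem isPlane_of_edges_eq_empty {K : G.Subgraph} (hK : K.Connected) (h : K.edges = ∅) :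
    K.IsPlane :=
  Subgraph.isPlane_iff.2 ⟨hK, by rw [hK.cappedEulerChar_of_edges_eq_empty h, sub_self]⟩

/-- The number of times that the pieces in `l`, put together one after the other to form `K`,
meet the preceding ones in a vertex without need. -/
noncomputable def surplus (l : List G.Subgraph) (K : G.Subgraph) : ℤ :=
  1 + (l.map fun H => (H.verts.ncard : ℤ) - 1).sum - K.verts.ncard

/-- Inclusion–exclusion: a piece meeting `K` in `m` vertices adds `m - 1`. -/
theorem surplus_append [Finite V] (l : List G.Subgraph) (K H : G.Subgraph) :
    surplus (l ++ [H]) (K.union H) = surplus l K + ((K.verts ∩ H.verts).ncard - 1) := by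
  have : (K.union H).verts.ncard + _ = _ := Set.ncard_union_add_ncard_inter K.verts H.verts
  simp only [surplus, List.map_append, List.sum_append, List.map_cons, List.map_nil,
    List.sum_cons, List.sum_nil]
  omega

variable [Finite V] [Finite E]

/-- `K` is connected and is the union of the distinct components of `G|_A` and of `G|_{Aᶜ}` in
the list `l`. -/
structure IsAssembly (A : Set E) (l : List G.Subgraph) (K : G.Subgraph) : Prop where
  nodup : l.Nodup
  mem_pieces : ∀ H ∈ l, H ∈ G.pieces A
  connected : K.Connected
  mem_verts : ∀ v, v ∈ K.verts ↔ ∃ H ∈ l, v ∈ H.verts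
  mem_edges : ∀ e, e ∈ K.edges ↔ ∃ H ∈ l, e ∈ H.edges

namespace IsAssembly

variable {l : List G.Subgraph} {K H : G.Subgraph}

theorem singleton (hH : H ∈ G.pieces A) : IsAssembly A [H] H where
  nodup := List.nodup_singleton H
  mem_pieces := by simpa using hH
  connected := pieces_connected hH
  mem_verts := by simp
  mem_edges := by simp

theorem append (h : IsAssembly A l K) (hH : H ∈ G.pieces A) (hl : H ∉ l)
    (hm : (K.verts ∩ H.verts).Nonempty) : IsAssembly A (l ++ [H]) (K.union H) where
  nodup := by
    rw [← List.concat_eq_append]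
    exact h.nodup.concat hl
  mem_pieces K' hK' := by
    rcases List.mem_append.1 hK' with hK' | hK'
    · exact h.mem_pieces K' hK'
    · rwa [List.mem_singleton.1 hK']
  connected := h.connected.union (pieces_connected hH) hm
  mem_verts v := by
    change v ∈ K.verts ∨ v ∈ H.verts ↔ _
    simp [h.mem_verts, or_and_right, exists_or]
  mem_edges e := by
    change e ∈ K.edges ∨ e ∈ H.edges ↔ _
    simp [h.mem_edges, or_and_right, exists_or]

theorem eq_full (hG : G.Connected) (h : IsAssembly A l K) (hl : ∀ H ∈ G.pieces A, H ∈ l) :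
    K = G.full := by
  have he : K.edges = Set.univ := by
    refine Set.eq_univ_of_forall fun e => ?_
    obtain ⟨x, rfl⟩ := G.edge_surjective e
    obtain ⟨H, hH, hx⟩ := exists_mem_pieces (G := G) A x
    exact (h.mem_edges _).2 ⟨H, hl H hH, hx⟩
  refine Subgraph.ext (Set.eq_univ_of_forall fun w => ?_) he
  obtain ⟨v, hv⟩ := h.connected.1
  refine Subgraph.mem_verts_of_reach ?_ hv
  rw [he]
  exact hG.2 v (Set.mem_univ _) w (Set.mem_univ _)

/-- As long as some piece is missing, one of the missing pieces meets the assembled ones. -/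
theorem exists_meeting (hG : G.Connected) (h : IsAssembly A l K)
    (hl : ¬ ∀ H ∈ G.pieces A, H ∈ l) :
    ∃ H ∈ G.pieces A, H ∉ l ∧ (K.verts ∩ H.verts).Nonempty := by
  by_contra hcon
  push Not at hcon hl
  obtain ⟨H, hH, hHl⟩ := hl
  obtain ⟨w, hw⟩ := (pieces_connected hH).1
  obtain ⟨v, hv⟩ := h.connected.1
  -- Walk along a path from `K`: the next edge lies in a piece meeting `K`, which by assumption has
  -- already been used, so its far end is in `K` too.
  have key : ∀ {u}, G.reachSetoid Set.univ v u → u ∈ K.verts := by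
    intro u hu
    induction hu with
    | refl => exact hv
    | tail _ hs ih =>
      obtain ⟨x, -, rfl, rfl⟩ := hs
      obtain ⟨L, hL, hx⟩ := exists_mem_pieces (G := G) A x
      have hxL := L.vert_mem x hx
      have hLl : L ∈ l := by
        by_contra hLl
        exact (Set.eq_empty_iff_forall_notMem.1 (hcon L hL hLl)) _ ⟨ih, hxL⟩
      exact (h.mem_verts _).2 ⟨L, hLl, L.vert_mem _ (by rwa [G.edge_side])⟩
  exact (Set.eq_empty_iff_forall_notMem.1 (hcon H hH hHl)) w
    ⟨key (hG.2 v (Set.mem_univ _) w (Set.mem_univ _)), hw⟩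

theorem sum_map_eq (hn : l.Nodup) (hl : ∀ H, H ∈ l ↔ H ∈ G.pieces A) :
    (l.map fun H => (H.verts.ncard : ℤ) - 1).sum = G.cycleRank A + Nat.card V - 1 := by
  classical
  have : l.toFinset = G.pieces A := by
    ext H
    rw [List.mem_toFinset, hl]
  rw [← sum_pieces_verts, ← this, List.sum_toFinset _ hn]

theorem surplus_eq_cycleRank (hG : G.Connected) (h : IsAssembly A l K)
    (hl : ∀ H ∈ G.pieces A, H ∈ l) : surplus l K = G.cycleRank A := by
  rw [surplus, sum_map_eq h.nodup fun H => ⟨h.mem_pieces H, hl H⟩, h.eq_full hG hl]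
  have : G.full.verts.ncard = Nat.card V := Set.ncard_univ V
  rw [this]
  ring

theorem card_missing_lt (l : List G.Subgraph) (hH : H ∈ G.pieces A) (hHl : H ∉ l) :
    {L | L ∈ G.pieces A ∧ L ∉ l ++ [H]}.ncard < {L | L ∈ G.pieces A ∧ L ∉ l}.ncard := by
  refine Set.ncard_lt_ncard ⟨?_, fun h => ?_⟩
  · exact fun L hL => ⟨hL.1, fun h => hL.2 (List.mem_append_left _ h)⟩
  · exact (h ⟨hH, hHl⟩ : H ∈ G.pieces A ∧ H ∉ l ++ [H]).2 (by simp)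

/-- Appending a piece that meets `K` never lowers the surplus, and once all pieces are used it
equals the cycle rank. -/
theorem surplus_le (hG : G.Connected) {l : List G.Subgraph} {K : G.Subgraph}
    (h : IsAssembly A l K) :
    surplus l K ≤ G.cycleRank A := by
  by_cases hl : ∀ H ∈ G.pieces A, H ∈ l
  · exact (h.surplus_eq_cycleRank hG hl).le
  · obtain ⟨H, hH, hHl, hm⟩ := h.exists_meeting hG hl
    have ih := surplus_le hG (h.append hH hHl hm)
    rw [surplus_append] at ih
    have := (Set.ncard_pos (s := K.verts ∩ H.verts)).2 hm
    omega
termination_by {L | L ∈ G.pieces A ∧ L ∉ l}.ncard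
decreasing_by exact card_missing_lt l hH hHl

variable (A) in
/-- One of the two given ribbon subgraphs is a component of `G|_A`, and the other one is a component
of `G|_{Aᶜ}`. -/
def Opposite (P Q : G.Subgraph) : Prop :=
  ((G.induced A).IsComponent P ∧ (G.induced Aᶜ).IsComponent Q) ∨
    ((G.induced Aᶜ).IsComponent P ∧ (G.induced A).IsComponent Q)

theorem opposite_of_ne {P Q : G.Subgraph} {v : V} (hP : P ∈ G.pieces A) (hQ : Q ∈ G.pieces A)
    (hne : P ≠ Q) (hvP : v ∈ P.verts) (hvQ : v ∈ Q.verts) : Opposite A P Q := by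
  rcases RibbonGraph.mem_pieces.1 hP with h | h <;> rcases RibbonGraph.mem_pieces.1 hQ with h' | h'
  · exact absurd (eq_of_isComponent_induced h h' hvP hvQ) hne
  · exact Or.inl ⟨h, h'⟩
  · exact Or.inr ⟨h, h'⟩
  · exact absurd (eq_of_isComponent_induced h h' hvP hvQ) hne

/-- The greedy assembly cannot fail: no partial assembly can have positive surplus, so each added
piece shares only one vertex with the preceding ones. -/
theorem exists_isOneSumSeq (hG : G.Connected) (h0 : G.cycleRank A = 0) {l : List G.Subgraph}
    {K : G.Subgraph} (h : IsAssembly A l K)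
    (hs : Subgraph.IsOneSumSeq (Opposite A) l K) :
    ∃ l' : List G.Subgraph, l'.Nodup ∧ (∀ H, H ∈ l' ↔ H ∈ G.pieces A) ∧
      Subgraph.IsOneSumSeq (Opposite A) l' G.full := by
  by_cases hl : ∀ H ∈ G.pieces A, H ∈ l
  · obtain rfl := h.eq_full hG hl
    exact ⟨l, h.nodup, fun H => ⟨h.mem_pieces H, hl H⟩, hs⟩
  · obtain ⟨H, hH, hHl, hm⟩ := h.exists_meeting hG hl
    have happ := h.append hH hHl hm
    refine exists_isOneSumSeq hG h0 happ ?_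
    -- A sequence of 1-sums has surplus `0`, so this bound reads `|K ∩ H| - 1 ≤ 0`.
    have hle := happ.surplus_le hG
    rw [surplus_append, h0, surplus, hs.ncard_verts] at hle
    have hpos := (Set.ncard_pos (s := K.verts ∩ H.verts)).2 hm
    obtain ⟨v, hv⟩ := Set.ncard_eq_one.1 (by omega : (K.verts ∩ H.verts).ncard = 1)
    have hvKH : v ∈ K.verts ∩ H.verts := hv ▸ Set.mem_singleton v
    obtain ⟨H', hH', hvH'⟩ := (h.mem_verts v).1 hvKH.1
    have hne : ∀ L ∈ l, L ≠ H := fun L hL hLH => hHl (hLH ▸ hL)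
    refine .snoc l K (K.union H) H H' v hs ⟨h.connected, pieces_connected hH, ?_, pieces_edges_nonempty hH,
      rfl, rfl, hv, ?_⟩ hH' hvH'
      (opposite_of_ne (h.mem_pieces H' hH') hH (hne H' hH') hvH' hvKH.2)
    · obtain ⟨e, he⟩ := pieces_edges_nonempty (h.mem_pieces H' hH')
      exact ⟨e, (h.mem_edges e).2 ⟨H', hH', he⟩⟩
    · refine Set.eq_empty_iff_forall_notMem.2 fun e he => ?_
      obtain ⟨L, hL, heL⟩ := (h.mem_edges e).1 he.1
      exact Set.eq_empty_iff_forall_notMem.1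
        (pieces_edges_disjoint (h.mem_pieces L hL) hH (hne L hL)) e ⟨heL, he.2⟩
termination_by {L | L ∈ G.pieces A ∧ L ∉ l}.ncard
decreasing_by exact card_missing_lt l hH hHl

end IsAssembly

/-! ### Biseparations in terms of cycle rank and genus -/

theorem cycleRank_univ (hG : G.Connected) : G.cycleRank Set.univ = 0 := by
  have h1 : G.numComponents Set.univ = 1 := by
    rw [numComponents, Nat.card_eq_one_iff_unique]
    refine ⟨⟨fun p q => ?_⟩, ?_⟩
    · induction p using Quotient.inductionOn with | h v =>
      induction q using Quotient.inductionOn with | h w =>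
      exact Quotient.sound (hG.2 v (Set.mem_univ _) w (Set.mem_univ _))
    · obtain ⟨v, -⟩ := hG.1
      exact ⟨Quotient.mk _ v⟩
  have h2 := sum_inducedComponents_verts (G := G) (B := ∅)
  have h3 : G.inducedComponents ∅ = ∅ := by
    refine Finset.eq_empty_of_forall_notMem fun K hK => ?_
    rw [mem_inducedComponents] at hK
    obtain ⟨e, he⟩ := edges_nonempty_of_isComponent_induced hK
    exact hK.1.1.2 he
  rw [h3, Finset.sum_empty] at h2
  rw [cycleRank, Set.compl_univ]
  omega

theorem edges_isEmpty_of_pieces_eq_empty (h : G.pieces A = ∅) : IsEmpty E := by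
  refine ⟨fun e => ?_⟩
  obtain ⟨x, rfl⟩ := G.edge_surjective e
  obtain ⟨K, hK, -⟩ := exists_mem_pieces (G := G) A x
  simp [h] at hK

/-- A single piece is an assembly of surplus `0`. Without pieces there are no edges, and `A` is
everything. -/
theorem cycleRank_nonneg (hG : G.Connected) (A : Set E) : 0 ≤ G.cycleRank A := by
  rcases (G.pieces A).eq_empty_or_nonempty with h | ⟨H, hH⟩
  · have := edges_isEmpty_of_pieces_eq_empty h
    rw [Set.eq_univ_of_forall (s := A) fun e => isEmptyElim e, cycleRank_univ hG]
  · have := (IsAssembly.singleton hH).surplus_le hG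
    simpa [surplus] using this

/-- A full sequence of 1-sums gives `|V| = 1 + ∑ (|V(H)| - 1)`, while over all pieces this sum is `c
+ |V| - 1`. Conversely, start from any piece and extend. -/
theorem definesBiseparation_iff (hG : G.Connected) :
    G.DefinesBiseparation A ↔ G.cycleRank A = 0 := by
  constructor
  · rintro (rfl | rfl | ⟨l, hn, hl, hs⟩)
    · exact cycleRank_univ hG
    · rw [← cycleRank_compl, Set.compl_empty, cycleRank_univ hG]
    · have h1 := IsAssembly.sum_map_eq hn fun H => (hl H).trans mem_pieces.symm
      have h2 := hs.ncard_verts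
      have h3 : G.full.verts.ncard = Nat.card V := Set.ncard_univ V
      omega
  · intro h
    rcases (G.pieces A).eq_empty_or_nonempty with h' | ⟨H, hH⟩
    · have := edges_isEmpty_of_pieces_eq_empty h'
      exact Or.inl (Set.eq_univ_of_forall fun e => isEmptyElim e)
    · obtain ⟨l, hn, hl, hs⟩ := (IsAssembly.singleton hH).exists_isOneSumSeq hG h
        (.single H (pieces_connected hH) (pieces_edges_nonempty hH))
      exact Or.inr (Or.inr ⟨l, hn, fun H => (hl H).trans mem_pieces, hs⟩)

/-- The components of `G - A` which are not components of `G|_{Aᶜ}` are isolated vertices. -/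
theorem isComponent_induced_or_delete_iff {K : G.Subgraph} :
    (G.induced A).IsComponent K ∨ (G.delete A).IsComponent K ↔
      K ∈ G.pieces A ∨ K.edges = ∅ ∧ (G.delete A).IsComponent K := by
  have h : (G.delete A).IsComponent K ↔ ∃ q, K = G.component Aᶜ q := isComponent_spanning_iff
  rw [mem_pieces, h, isComponent_induced_iff (B := Aᶜ)]
  constructor
  · rintro (hK | ⟨q, hK⟩)
    · exact Or.inl (Or.inl hK)
    · rcases K.edges.eq_empty_or_nonempty with he | he
      · exact Or.inr ⟨he, q, hK⟩
      · exact Or.inl (Or.inr ⟨q, hK, he⟩)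
  · rintro ((hK | ⟨q, hK, -⟩) | ⟨-, hK⟩)
    · exact Or.inl hK
    · exact Or.inr ⟨q, hK⟩
    · exact Or.inr hK

variable [Finite F]

theorem definesPlaneBiseparation_iff (hG : G.Connected) :
    G.DefinesPlaneBiseparation A ↔
      G.cycleRank A = 0 ∧ G.totalGenus A + G.totalGenus Aᶜ = 0 := by
  rw [DefinesPlaneBiseparation, definesBiseparation_iff hG, ← sum_pieces_genus,
    Finset.sum_eq_zero_iff_of_nonneg fun K hK =>
      sub_nonneg.2 (pieces_connected hK).cappedEulerChar_le_two]
  refine and_congr_right fun _ => ⟨fun h K hK => ?_, fun h K hK => ?_⟩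
  · exact (Subgraph.isPlane_iff.1 (h K (isComponent_induced_or_delete_iff.2 (Or.inl hK)))).2
  · rcases isComponent_induced_or_delete_iff.1 hK with hK | ⟨he, hK⟩
    · exact Subgraph.isPlane_iff.2 ⟨pieces_connected hK, h K hK⟩
    · exact isPlane_of_edges_eq_empty hK.1.2 he

theorem definesRP2Biseparation_iff (hG : G.Connected) :
    G.DefinesRP2Biseparation A ↔
      G.cycleRank A = 0 ∧ G.totalGenus A + G.totalGenus Aᶜ = 1 := by
  rw [DefinesRP2Biseparation, definesBiseparation_iff hG, ← sum_pieces_genus,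
    Finset.sum_int_eq_one_iff fun K hK =>
      sub_nonneg.2 (pieces_connected hK).cappedEulerChar_le_two]
  refine and_congr_right fun _ => ⟨?_, ?_⟩
  · rintro ⟨K, hK, hK1, h⟩
    have hK1 := (Subgraph.isRP2_iff.1 hK1).2
    refine ⟨K, ?_, hK1, fun K' hK' hne => ?_⟩
    · rcases isComponent_induced_or_delete_iff.1 hK with hK | ⟨he, hK⟩
      · exact hK
      -- An isolated vertex has Euler genus `0`, so it cannot be the exceptional component.
      · rw [hK.1.2.cappedEulerChar_of_edges_eq_empty he] at hK1
        norm_num at hK1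
    · exact (Subgraph.isPlane_iff.1
        (h K' (isComponent_induced_or_delete_iff.2 (Or.inl hK')) hne)).2
  · rintro ⟨K, hK, hK1, h⟩
    refine ⟨K, isComponent_induced_or_delete_iff.2 (Or.inl hK),
      Subgraph.isRP2_iff.2 ⟨pieces_connected hK, hK1⟩, fun K' hK' hne => ?_⟩
    rcases isComponent_induced_or_delete_iff.1 hK' with hK' | ⟨he, hK'⟩
    · exact Subgraph.isPlane_iff.2 ⟨pieces_connected hK', h K' hK' hne⟩
    · exact isPlane_of_edges_eq_empty hK'.1.2 he

end RibbonGraph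

theorem theorem4p2 {V E F : Type*} [Finite V] [Finite E] [Finite F]
    (G : RibbonGraph V E F) (hG : G.Connected) (A : Set E) :
    ((G.partialDual A).IsPlane ↔ G.DefinesPlaneBiseparation A) ∧
    ((G.partialDual A).IsRP2 ↔ G.DefinesRP2Biseparation A) := by
  have hconn : (G.partialDual A).full.Connected := hG.partialDual A
  have hχ := G.two_sub_cappedEulerChar_partialDual A
  have h1 := RibbonGraph.cycleRank_nonneg hG A
  have h2 := G.totalGenus_nonneg A
  have h3 := G.totalGenus_nonneg Aᶜ
  rw [RibbonGraph.IsPlane, RibbonGraph.IsRP2, RibbonGraph.Subgraph.isPlane_iff,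
    RibbonGraph.Subgraph.isRP2_iff, and_iff_right hconn, and_iff_right hconn, hχ,
    RibbonGraph.definesPlaneBiseparation_iff hG, RibbonGraph.definesRP2Biseparation_iff hG]
  -- All terms are nonnegative integers and the cycle rank enters doubled, so a total of `0` or `1`
  -- forces it to vanish.
  omega
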